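/- Let $p$ be a prime number, let $G$ be a $p$-adic analytic group (that is, a topological group whose topology underlies the structure of a finite-dimensional analytic manifold over $\mathbb{Q}_p$ for which multiplication and inversion are analytic; $G$ need not be compact), and let $k$ be a field of positive characteristic, not necessarily equal to $p$. For a representation $V$ of $G$ on a $k$-vector space (with no continuity condition), let $$V^{\mathrm{sm}} := \bigcup_{K} V^K, \qquad V^K := \{v \in V : xv = v \text{ for all } x \in K\},$$ where $K$ runs through the compact open subgroups of $G$; this is a subrepresentation of $V$, called the smooth part of $V$. Then, for every representation $V$ of $G$ on a $k$-vector space, $$(V/V^{\mathrm{sm}})^{\mathrm{sm}} = \{0\}.$$ -/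

import Mathlib

open scoped Manifold ContDiff

/-- A topological group `G` is `p`-adic analytic if its topology underlies the structure of a
finite-dimensional analytic manifold over `ℚ_p` for which multiplication and inversion are
analytic, i.e. if it is the topological group of a Lie group over `ℚ_p`
(in Mathlib, the order of smoothness `ω` means analytic). -/
def IsPAdicAnalyticGroup (p : ℕ) [Fact p.Prime] (G : Type*) [Group G] [TopologicalSpace G] :
    Prop :=
  ∃ (d : ℕ) (_ : ChartedSpace (Fin d → ℚ_[p]) G), LieGroup 𝓘(ℚ_[p], Fin d → ℚ_[p]) ω G

namespace SmoothRep

section Definitions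

variable {k G V : Type*} [Field k] [Group G] [AddCommGroup V] [Module k V]

/-- The space `V^K` of vectors fixed by the subgroup `K`. -/
noncomputable def fixedBy (ρ : Representation k G V) (K : Subgroup G) : Submodule k V :=
  Representation.invariants (ρ.comp K.subtype)

theorem mem_fixedBy (ρ : Representation k G V) (K : Subgroup G) (v : V) :
    v ∈ fixedBy ρ K ↔ ∀ x ∈ K, ρ x v = v :=
  ⟨fun h x hx => h ⟨x, hx⟩, fun h x => h x.1 x.2⟩

variable [TopologicalSpace G]

/-- The smooth part `V^sm`, the sum of the subspaces `V^K` over all compact open subgroups `K`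
of `G`. When `G` has a compact open subgroup this sum is the union of the `V^K`
(`mem_smoothPart_iff`); every `p`-adic analytic group has one
(`IsPAdicAnalyticGroup.exists_compact_open_subgroup`). -/
noncomputable def smoothPart (ρ : Representation k G V) : Submodule k V :=
  ⨆ K : {K : Subgroup G // IsOpen (K : Set G) ∧ IsCompact (K : Set G)}, fixedBy ρ K.1

variable [IsTopologicalGroup G]

/-- The smooth part is stable under the action of `G`. -/
theorem smoothPart_le_comap (ρ : Representation k G V) (g : G) :
    smoothPart ρ ≤ (smoothPart ρ).comap (ρ g) := by
  refine iSup_le fun K v hv => ?_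
  rw [mem_fixedBy] at hv
  have hcont : Continuous fun x : G => g⁻¹ * x * g := by fun_prop
  let L : Subgroup G := K.1.map (MulAut.conj g).toMonoidHom
  have hL : (L : Set G) = (fun x : G => g⁻¹ * x * g) ⁻¹' (K.1 : Set G) := by
    ext x
    simp only [L, Subgroup.coe_map, Set.mem_image, Set.mem_preimage, SetLike.mem_coe]
    constructor
    · rintro ⟨y, hy, rfl⟩
      simpa [mul_assoc] using hy
    · intro h
      exact ⟨_, h, by simp [mul_assoc]⟩
  have hLo : IsOpen (L : Set G) := hL ▸ K.2.1.preimage hcont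
  have hLc : IsCompact (L : Set G) := by
    have h : Continuous fun x : G => g * x * g⁻¹ := by fun_prop
    exact K.2.2.image h
  refine Submodule.mem_iSup_of_mem (p := fun K :
    {K : Subgroup G // IsOpen (K : Set G) ∧ IsCompact (K : Set G)} => fixedBy ρ K.1)
    ⟨L, hLo, hLc⟩ ?_
  rw [mem_fixedBy]
  rintro _ ⟨y, hy, rfl⟩
  have h : MulAut.conj g y * g = g * y := by simp
  change ρ (MulAut.conj g y) (ρ g v) = ρ g v
  rw [← Module.End.mul_apply, ← map_mul, h, map_mul, Module.End.mul_apply, hv y hy]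

/-- The representation of `G` on `V / V^sm`. -/
noncomputable def quotientSmoothPart (ρ : Representation k G V) : Representation k G (V ⧸ smoothPart ρ) :=
  ρ.quotient (smoothPart ρ) (smoothPart_le_comap ρ)

/-- When `G` has a compact open subgroup, `V^sm` is the union of the `V^K`. -/
theorem mem_smoothPart_iff (hG : ∃ K : Subgroup G, IsOpen (K : Set G) ∧ IsCompact (K : Set G))
    (ρ : Representation k G V) (v : V) :
    v ∈ smoothPart ρ ↔ ∃ K : Subgroup G, IsOpen (K : Set G) ∧ IsCompact (K : Set G) ∧
      ∀ x ∈ K, ρ x v = v := by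
  obtain ⟨K₀, hK₀⟩ := hG
  have : Nonempty {K : Subgroup G // IsOpen (K : Set G) ∧ IsCompact (K : Set G)} := ⟨⟨K₀, hK₀⟩⟩
  rw [smoothPart, Submodule.mem_iSup_of_directed]
  · simp only [Subtype.exists, mem_fixedBy, exists_prop, and_assoc]
  · intro K L
    refine ⟨⟨K.1 ⊓ L.1, K.2.1.inter L.2.1,
      K.2.2.inter_right (Subgroup.isClosed_of_isOpen _ L.2.1)⟩, ?_, ?_⟩
    · intro v hv
      rw [mem_fixedBy] at hv ⊢
      exact fun x hx => hv x hx.1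
    · intro v hv
      rw [mem_fixedBy] at hv ⊢
      exact fun x hx => hv x hx.2

end Definitions

end SmoothRep

open Pointwise in
/-- A `p`-adic analytic group has a compact open subgroup. -/
theorem IsPAdicAnalyticGroup.exists_compact_open_subgroup {p : ℕ} [Fact p.Prime] {G : Type*}
    [Group G] [TopologicalSpace G] [IsTopologicalGroup G] (hG : IsPAdicAnalyticGroup p G) :
    ∃ K : Subgroup G, IsOpen (K : Set G) ∧ IsCompact (K : Set G) := by
  obtain ⟨d, hC, -⟩ := hG
  -- a compact open neighbourhood `C` of `1`
  obtain ⟨C, hCo, hCc, h1⟩ : ∃ C : Set G, IsOpen C ∧ IsCompact C ∧ (1 : G) ∈ C := by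
    let φ := chartAt (Fin d → ℚ_[p]) (1 : G)
    obtain ⟨ε, hε, hsub⟩ := Metric.nhds_basis_closedBall.mem_iff.1
      (φ.open_target.mem_nhds (φ.map_source (mem_chart_source _ (1 : G))))
    have ho : IsOpen (Metric.closedBall (φ 1) ε) := by
      rw [closedBall_pi _ hε.le]
      exact isOpen_set_pi Set.finite_univ
        fun i _ => IsUltrametricDist.isOpen_closedBall _ hε.ne'
    refine ⟨φ.symm '' Metric.closedBall (φ 1) ε, ?_, ?_, ?_⟩
    · exact φ.isOpen_image_symm_of_subset_target ho hsub
    · exact (isCompact_closedBall _ _).image_of_continuousOn (φ.continuousOn_symm.mono hsub)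
    · exact ⟨φ 1, Metric.mem_closedBall_self hε.le, φ.left_inv (mem_chart_source _ (1 : G))⟩
  -- the right stabilizer of `C`
  let H : Subgroup G :=
    { carrier := {g | ∀ x, x * g ∈ C ↔ x ∈ C}
      one_mem' := fun x => by simp
      mul_mem' := fun {a b} ha hb x => by rw [← mul_assoc, hb, ha]
      inv_mem' := fun {a} ha x => by rw [← ha (x * a⁻¹), inv_mul_cancel_right] }
  obtain ⟨T, hT, hCT⟩ := compact_open_separated_mul_right hCc hCo subset_rfl
  have hHo : IsOpen (H : Set G) := by
    refine Subgroup.isOpen_of_mem_nhds H (g := 1) ?_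
    filter_upwards [hT, inv_mem_nhds_one G hT] with g hg hg' x
    refine ⟨fun h => ?_, fun h => hCT (Set.mul_mem_mul h hg)⟩
    simpa using hCT (Set.mul_mem_mul h (Set.mem_inv.1 hg'))
  refine ⟨H, hHo, hCc.of_isClosed_subset (Subgroup.isClosed_of_isOpen _ hHo) fun g hg => ?_⟩
  simpa using (hg 1).2 h1

/-!
Let the class of `v` in `V / V^sm` be fixed by a compact open subgroup `K`, so that `ρ g v - v` is
smooth for all `g ∈ K`. On the closure of the powers of some `g ∈ K`, which is abelian and compact,
smoothness of these differences yields `m ≠ 0` such that `(ρ b - 1)² v = 0` for all `b` in the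
closure `B` of the powers of `g ^ m`. Then `ρ (b ^ n) v = v + n • (ρ b v - v) = v` for
`n = char k`, and by compactness the `n`-th powers of `B` fill the closure of the powers of
`g ^ (m * n)`, which therefore fixes `v`. A `p`-adic analytic group is, near `1`, a finite product
of such closures, whatever the exponents: in suitable ultrametric coordinates its multiplication is
a small perturbation of the addition. Hence the stabilizer of `v` is open.
-/

open Filter Metric Pointwise Set Topology

section ClosedZPowers

variable {G : Type*} [Group G] [TopologicalSpace G] [IsTopologicalGroup G]

/-- The closed subgroup of `G` topologically generated by `g`; it is procyclic when `G` is
profinite. -/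
def closedZPowers (g : G) : Subgroup G :=
  (Subgroup.zpowers g).topologicalClosure

theorem isClosed_closedZPowers (g : G) : IsClosed (closedZPowers g : Set G) :=
  Subgroup.isClosed_topologicalClosure _

theorem zpowers_le_closedZPowers (g : G) : Subgroup.zpowers g ≤ closedZPowers g :=
  Subgroup.le_topologicalClosure _

theorem closedZPowers_le {H : Subgroup G} (hH : IsClosed (H : Set G)) {g : G} (hg : g ∈ H) :
    closedZPowers g ≤ H :=
  Subgroup.topologicalClosure_minimal _ (Subgroup.zpowers_le.2 hg) hH

theorem closedZPowers_pow_le (g : G) (n : ℕ) : closedZPowers (g ^ n) ≤ closedZPowers g :=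
  closedZPowers_le (isClosed_closedZPowers g)
    (zpowers_le_closedZPowers g (Subgroup.npow_mem_zpowers g n))

theorem commute_of_mem_closedZPowers [T2Space G] {g b : G} (hb : b ∈ closedZPowers g) :
    Commute g b :=
  closedZPowers_le (H := Subgroup.centralizer {g}) (Set.isClosed_centralizer _)
    (Subgroup.mem_centralizer_singleton_iff.2 rfl) hb g rfl

theorem closedZPowers_pow_subset_image_pow [T2Space G] {g : G}
    (hg : IsCompact (closedZPowers g : Set G)) (n : ℕ) :
    (closedZPowers (g ^ n) : Set G) ⊆ (fun b => b ^ n) '' (closedZPowers g : Set G) := by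
  refine closure_minimal ?_ (hg.image (continuous_pow n)).isClosed
  rintro _ ⟨j, rfl⟩
  refine ⟨g ^ j, zpowers_le_closedZPowers g ⟨j, rfl⟩, ?_⟩
  simp only [← zpow_natCast, ← zpow_mul, mul_comm]

theorem exists_pow_mem_of_isCompact_of_isOpen {K U : Subgroup G} (hK : IsCompact (K : Set G))
    (hU : IsOpen (U : Set G)) {g : G} (hg : g ∈ K) : ∃ m : ℕ, m ≠ 0 ∧ g ^ m ∈ U := by
  have : CompactSpace K := isCompact_iff_compactSpace.1 hK
  have : Finite (K ⧸ U.subgroupOf K) :=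
    Subgroup.quotient_finite_of_isOpen _ (hU.preimage continuous_subtype_val)
  have : (U.subgroupOf K).FiniteIndex := Subgroup.finiteIndex_of_finite_quotient
  obtain ⟨m, hm, -, hgm⟩ := Subgroup.exists_pow_mem_of_index_ne_zero
    (H := U.subgroupOf K) Subgroup.FiniteIndex.index_ne_zero ⟨g, hg⟩
  exact ⟨m, hm.ne', hgm⟩

variable (G) in
/-- A topological group is locally a finite product of closed cyclic subgroups if, arbitrarily close
to `1`, it has finitely many elements `g i` for which the set of all products `x₁ ⋯ x_d` with `x i`
in the closure of the powers of `g i ^ M` is a neighbourhood of `1`, whatever the exponent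
`M ≠ 0`. -/
def IsLocallyProductOfClosedZPowers : Prop :=
  ∀ U ∈ 𝓝 (1 : G), ∃ (d : ℕ) (g : Fin d → G), (∀ i, g i ∈ U) ∧ ∀ M : ℕ, M ≠ 0 →
    (List.ofFn fun i => (closedZPowers (g i ^ M) : Set G)).prod ∈ 𝓝 (1 : G)

theorem isOpen_of_closedZPowers_pow_le {H : Subgroup G} {d : ℕ} {g : Fin d → G}
    (hg : ∀ M : ℕ, M ≠ 0 →
      (List.ofFn fun i => (closedZPowers (g i ^ M) : Set G)).prod ∈ 𝓝 (1 : G))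
    (hH : ∀ i, ∃ M : ℕ, M ≠ 0 ∧ closedZPowers (g i ^ M) ≤ H) : IsOpen (H : Set G) := by
  choose M hM hMH using hH
  refine H.isOpen_of_mem_nhds (g := 1) <|
    mem_of_superset (hg (∏ i, M i) (Finset.prod_ne_zero_iff.2 fun i _ => hM i)) fun y hy => ?_
  obtain ⟨x, rfl⟩ := Set.mem_prod_list_ofFn.1 hy
  refine list_prod_mem <| List.forall_mem_ofFn_iff.2 fun i => hMH i ?_
  obtain ⟨m, hm⟩ := Finset.dvd_prod_of_mem M (Finset.mem_univ i)
  exact closedZPowers_pow_le (g i ^ M i) m (by rw [← pow_mul, ← hm]; exact (x i).2)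

end ClosedZPowers

namespace SmoothRep

section Stabilizer

variable {k G V : Type*} [CommRing k] [Group G] [AddCommGroup V] [Module k V]
  (ρ : Representation k G V)

/-- The subgroup of the elements of `G` that fix the vector `v`. -/
def stabilizer (v : V) : Subgroup G :=
  letI := MulAction.compHom V ρ
  MulAction.stabilizer G v

variable {ρ}

theorem mem_stabilizer {v : V} {g : G} : g ∈ stabilizer ρ v ↔ ρ g v = v :=
  Iff.rfl

theorem apply_pow_eq_add_smul {v : V} {b : G} (hb : b ∈ stabilizer ρ (ρ b v - v)) (n : ℕ) :
    ρ (b ^ n) v = v + (n : k) • (ρ b v - v) := by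
  induction n with
  | zero => simp
  | succ n ih =>
    rw [pow_succ', map_mul, Module.End.mul_apply, ih, map_add, map_smul, mem_stabilizer.1 hb]
    push_cast
    module

theorem pow_mem_stabilizer {v : V} {b : G} (hb : b ∈ stabilizer ρ (ρ b v - v)) {n : ℕ}
    (hn : (n : k) = 0) : b ^ n ∈ stabilizer ρ v := by
  rw [mem_stabilizer, apply_pow_eq_add_smul hb, hn, zero_smul, add_zero]

theorem mem_stabilizer_apply_sub_comm {g b : G} (h : Commute g b) {v : V} :
    g ∈ stabilizer ρ (ρ b v - v) ↔ b ∈ stabilizer ρ (ρ g v - v) := by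
  have hgb : ρ g (ρ b v) = ρ b (ρ g v) := by
    rw [← Module.End.mul_apply, ← map_mul, h.eq, map_mul, Module.End.mul_apply]
  simp only [mem_stabilizer, map_sub, hgb, sub_eq_sub_iff_add_eq_add]
  rw [← sub_eq_zero, ← sub_eq_zero (a := ρ b (ρ g v) + v)]
  abel_nf

variable [TopologicalSpace G] [IsTopologicalGroup G] [T2Space G]

-- On the abelian group `closedZPowers g`, the cocycle `b ↦ ρ b v - v` satisfies
-- `(b - 1)(g - 1)v = (g - 1)(b - 1)v`. So if `b` fixes its value at `g`, then `g`, and by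
-- smoothness all of `closedZPowers g`, fixes its value at `b`.
theorem mem_stabilizer_apply_sub_self {v : V} {g b : G} (hb : b ∈ closedZPowers g)
    (hbv : IsOpen (stabilizer ρ (ρ b v - v) : Set G)) (hbg : b ∈ stabilizer ρ (ρ g v - v)) :
    b ∈ stabilizer ρ (ρ b v - v) :=
  closedZPowers_le (Subgroup.isClosed_of_isOpen _ hbv)
    ((mem_stabilizer_apply_sub_comm (commute_of_mem_closedZPowers hb)).2 hbg) hb

theorem exists_closedZPowers_pow_le_stabilizer {n : ℕ} (hn : n ≠ 0) (hnk : (n : k) = 0) {v : V}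
    {K : Subgroup G} (hK : IsCompact (K : Set G))
    (hv : ∀ g ∈ K, IsOpen (stabilizer ρ (ρ g v - v) : Set G)) {g : G} (hg : g ∈ K) :
    ∃ M : ℕ, M ≠ 0 ∧ closedZPowers (g ^ M) ≤ stabilizer ρ v := by
  obtain ⟨m, hm, hgm⟩ := exists_pow_mem_of_isCompact_of_isOpen hK (hv g hg) hg
  have hmK : closedZPowers (g ^ m) ≤ K := closedZPowers_le hK.isClosed (K.pow_mem hg m)
  have hmg : closedZPowers (g ^ m) ≤ stabilizer ρ (ρ g v - v) :=
    closedZPowers_le (Subgroup.isClosed_of_isOpen _ (hv g hg)) hgm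
  refine ⟨m * n, mul_ne_zero hm hn, fun x hx => ?_⟩
  rw [pow_mul] at hx
  obtain ⟨b, hb, rfl⟩ := closedZPowers_pow_subset_image_pow
    (hK.of_isClosed_subset (isClosed_closedZPowers _) hmK) n hx
  exact pow_mem_stabilizer
    (mem_stabilizer_apply_sub_self (closedZPowers_pow_le g m hb) (hv b (hmK hb)) (hmg hb)) hnk

end Stabilizer

theorem mem_smoothPart_iff_isOpen_stabilizer {k G V : Type*} [Field k] [Group G]
    [TopologicalSpace G] [IsTopologicalGroup G] [AddCommGroup V] [Module k V]
    {ρ : Representation k G V}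
    (hK : ∃ K : Subgroup G, IsOpen (K : Set G) ∧ IsCompact (K : Set G)) {v : V} :
    v ∈ smoothPart ρ ↔ IsOpen (stabilizer ρ v : Set G) := by
  rw [mem_smoothPart_iff hK]
  constructor
  · rintro ⟨K, hKo, -, hKv⟩
    exact Subgroup.isOpen_mono (H₁ := K) hKv hKo
  · intro hv
    obtain ⟨K, hKo, hKc⟩ := hK
    exact ⟨K ⊓ stabilizer ρ v, hKo.inter hv,
      hKc.inter_right (Subgroup.isClosed_of_isOpen _ hv), fun x hx => hx.2⟩

end SmoothRep

theorem norm_le_of_norm_sub_le {E : Type*} [NormedAddCommGroup E] [IsUltrametricDist E] {x y : E}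
    {R : ℝ} (hxy : ‖x - y‖ ≤ R) (hy : ‖y‖ ≤ R) : ‖x‖ ≤ R := by
  simpa using (IsUltrametricDist.norm_add_le_max (x - y) y).trans (max_le hxy hy)

/-- Coordinates on a neighbourhood `domain` of `1` in `G`, closed under multiplication, that
identify it with a closed ball in `E` and in which the multiplication of `G` differs from the
addition of `E` by an `ε`-Lipschitz map. It plays the role of a standard subgroup of a `p`-adic
analytic group. -/
structure AlmostAdditiveChart (G E : Type*) [Group G] [TopologicalSpace G]
    [NormedAddCommGroup E] (ε : ℝ) where
  /-- the neighbourhood of `1` on which the coordinates are used -/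
  domain : Submonoid G
  /-- the coordinates, with junk values outside `domain` -/
  coord : G → E
  /-- the radius of the ball -/
  radius : ℝ
  radius_pos : 0 < radius
  domain_mem_nhds : (domain : Set G) ∈ 𝓝 1
  isCompact_domain : IsCompact (domain : Set G)
  continuousOn_coord : ContinuousOn coord domain
  bijOn_coord : BijOn coord domain (closedBall 0 radius)
  coord_one : coord 1 = 0
  norm_coord_mul_sub_le : ∀ g ∈ domain, ∀ h ∈ domain, ∀ g' ∈ domain, ∀ h' ∈ domain,
    ‖coord (g * h) - coord (g' * h') - (coord g - coord g' + (coord h - coord h'))‖ ≤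
      ε * max ‖coord g - coord g'‖ ‖coord h - coord h'‖

namespace AlmostAdditiveChart

section General

variable {G E : Type*} [Group G] [TopologicalSpace G] [NormedAddCommGroup E] {ε : ℝ}
  (P : AlmostAdditiveChart G E ε)

theorem setOf_norm_coord_le_mem_nhds {t : ℝ} (ht : 0 < t) :
    {g ∈ P.domain | ‖P.coord g‖ ≤ t} ∈ 𝓝 (1 : G) := by
  have hcont : ContinuousAt P.coord 1 := P.continuousOn_coord.continuousAt P.domain_mem_nhds
  filter_upwards [P.domain_mem_nhds,
    hcont.preimage_mem_nhds (closedBall_mem_nhds _ ht)] with g hg hgt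
  exact ⟨hg, by simpa [P.coord_one] using hgt⟩

theorem norm_coord_mul_sub_add_le {g b : G} (hg : g ∈ P.domain) (hb : b ∈ P.domain) :
    ‖P.coord (g * b) - P.coord g - P.coord b‖ ≤ ε * ‖P.coord b‖ := by
  simpa [P.coord_one] using
    P.norm_coord_mul_sub_le g hg b hb g hg 1 P.domain.one_mem

variable [IsUltrametricDist E]

theorem norm_coord_prod_sub_sum_le (hε0 : 0 ≤ ε) (hε1 : ε ≤ 1) {n : ℕ} {g g' : Fin n → G}
    (hg : ∀ i, g i ∈ P.domain) (hg' : ∀ i, g' i ∈ P.domain) {R : ℝ} (hR : 0 ≤ R)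
    (h : ∀ i, ‖P.coord (g i) - P.coord (g' i)‖ ≤ R) :
    ‖P.coord (List.ofFn g).prod - P.coord (List.ofFn g').prod -
      ∑ i, (P.coord (g i) - P.coord (g' i))‖ ≤ ε * R := by
  induction n with
  | zero => simpa using mul_nonneg hε0 hR
  | succ n ih =>
    have htail := ih (fun i => hg i.succ) (fun i => hg' i.succ) fun i => h i.succ
    have htail' := norm_le_of_norm_sub_le (htail.trans (mul_le_of_le_one_left hR hε1))
      (IsUltrametricDist.norm_sum_le_of_forall_le_of_nonneg hR fun i _ => h i.succ)
    have hhead := P.norm_coord_mul_sub_le _ (hg 0)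
      _ (list_prod_mem (List.forall_mem_ofFn_iff.2 fun i => hg i.succ))
      _ (hg' 0) _ (list_prod_mem (List.forall_mem_ofFn_iff.2 fun i => hg' i.succ))
    refine norm_le_of_norm_sub_le ?_ htail
    simp only [List.ofFn_succ, List.prod_cons, Fin.sum_univ_succ]
    refine (congrArg norm ?_).trans_le
      (hhead.trans (mul_le_mul_of_nonneg_left (max_le (h 0) htail') hε0))
    abel

theorem norm_coord_pow_sub_nsmul_le (hε0 : 0 ≤ ε) (hε1 : ε ≤ 1) {g : G} (hg : g ∈ P.domain)
    (n : ℕ) : ‖P.coord (g ^ n) - n • P.coord g‖ ≤ ε * ‖P.coord g‖ := by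
  simpa [P.coord_one, List.ofFn_const] using P.norm_coord_prod_sub_sum_le hε0 hε1 (n := n)
    (fun _ => hg) (fun _ => P.domain.one_mem) (norm_nonneg (P.coord g))
    fun _ => by rw [P.coord_one, sub_zero]

theorem norm_coord_prod_mul_sub_lt (hε0 : 0 ≤ ε) (hε1 : ε < 1) {n : ℕ} {c b : Fin n → G}
    (hc : ∀ i, c i ∈ P.domain) (hb : ∀ i, b i ∈ P.domain) {u : E} (hu : u ≠ 0)
    (hbu : ∀ i, ‖P.coord (b i)‖ ≤ ‖u‖) (hsum : ‖∑ i, P.coord (b i) - u‖ < ‖u‖) :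
    ‖P.coord (List.ofFn (c * b)).prod - P.coord (List.ofFn c).prod - u‖ < ‖u‖ := by
  have hmul (i) : ‖P.coord (c i * b i) - P.coord (c i) - P.coord (b i)‖ ≤ ε * ‖u‖ :=
    (P.norm_coord_mul_sub_add_le (hc i) (hb i)).trans (mul_le_mul_of_nonneg_left (hbu i) hε0)
  have hεu : ε * ‖u‖ < ‖u‖ := mul_lt_of_lt_one_left (norm_pos_iff.2 hu) hε1
  have hprod : ‖P.coord (List.ofFn (c * b)).prod - P.coord (List.ofFn c).prod -
      ∑ i, (P.coord (c i * b i) - P.coord (c i))‖ ≤ ε * ‖u‖ :=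
    P.norm_coord_prod_sub_sum_le hε0 hε1.le (fun i => mul_mem (hc i) (hb i)) hc (norm_nonneg u)
      fun i => norm_le_of_norm_sub_le ((hmul i).trans hεu.le) (hbu i)
  have hsum' : ‖∑ i, (P.coord (c i * b i) - P.coord (c i)) - ∑ i, P.coord (b i)‖ ≤ ε * ‖u‖ := by
    rw [← Finset.sum_sub_distrib]
    exact IsUltrametricDist.norm_sum_le_of_forall_le_of_nonneg (by positivity) fun i _ => hmul i
  refine (norm_le_of_norm_sub_le ?_ (le_max_right (ε * ‖u‖) _)).trans_lt (max_lt hεu hsum)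
  refine (norm_le_of_norm_sub_le ?_ hsum').trans (le_max_left _ _)
  simpa using hprod

variable [IsTopologicalGroup G]

-- Among the products of elements of the `S i ∩ domain`, one that is closest to `g` in coordinates
-- exists by compactness, and any other than `g` itself could be improved.
theorem mem_list_prod_of_norm_coord_le (hε0 : 0 ≤ ε) (hε1 : ε < 1) {n : ℕ}
    {S : Fin n → Submonoid G} (hS : ∀ i, IsClosed (S i : Set G)) {t : ℝ}
    (happrox : ∀ u : E, u ≠ 0 → ‖u‖ ≤ t → ∃ b : Fin n → G, (∀ i, b i ∈ P.domain ⊓ S i) ∧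
      (∀ i, ‖P.coord (b i)‖ ≤ ‖u‖) ∧ ‖∑ i, P.coord (b i) - u‖ < ‖u‖)
    {g : G} (hg : g ∈ P.domain) (hgt : ‖P.coord g‖ ≤ t) :
    g ∈ (List.ofFn fun i => (S i : Set G)).prod := by
  let C : Set (Fin n → G) := univ.pi fun i => ((P.domain ⊓ S i : Submonoid G) : Set G)
  let res (c : Fin n → G) : E := P.coord g - P.coord (List.ofFn c).prod
  have hprod {c} (hc : c ∈ C) : (List.ofFn c).prod ∈ P.domain :=
    list_prod_mem (List.forall_mem_ofFn_iff.2 fun i => (hc i trivial).1)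
  have h1 : (fun _ => 1) ∈ C := fun i _ => one_mem (P.domain ⊓ S i)
  have hcont : ContinuousOn (fun c => ‖res c‖) C := by
    have : Continuous fun c : Fin n → G => (List.ofFn c).prod := by
      simp only [List.ofFn_eq_map]
      exact continuous_list_prod _ fun i _ => continuous_apply i
    exact (continuousOn_const.sub
      (P.continuousOn_coord.comp this.continuousOn fun c hc => hprod hc)).norm
  obtain ⟨c, hc, hmin⟩ := (isCompact_univ_pi fun i =>
    P.isCompact_domain.inter_right (hS i)).exists_isMinOn ⟨1, h1⟩ hcont
  have hres : res c = 0 := by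
    by_contra hne
    have hct : ‖res c‖ ≤ t := (hmin h1).trans <| by
      simpa [res, P.coord_one, List.ofFn_const] using hgt
    obtain ⟨b, hb, hbu, hsum⟩ := happrox _ hne hct
    have hlt := P.norm_coord_prod_mul_sub_lt hε0 hε1 (fun i => (hc i trivial).1)
      (fun i => (hb i).1) hne hbu hsum
    refine hlt.not_ge ((hmin (a := c * b) fun i _ => mul_mem (hc i trivial) (hb i)).trans_eq ?_)
    simp only [res, sub_sub_sub_cancel_right, norm_sub_rev (P.coord g)]
  rw [P.bijOn_coord.injOn hg (hprod hc) (sub_eq_zero.1 hres)]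
  exact Set.mem_prod_list_ofFn.2 ⟨fun i => ⟨c i, (hc i trivial).2⟩, rfl⟩

end General

section Padic

variable {p : ℕ} [Fact p.Prime] {G E : Type*} [Group G] [TopologicalSpace G]
  [NormedAddCommGroup E] [NormedSpace ℚ_[p] E] [IsUltrametricDist E]
  (P : AlmostAdditiveChart G E ((p : ℝ)⁻¹ ^ 2))

-- The case `n = p` dictates `ε = p⁻²`: the error `ε ‖coord g‖` has to be smaller than
-- `‖p • coord g‖ = p⁻¹ ‖coord g‖`.
theorem norm_coord_pow_sub_smul_le {g : G} (hg : g ∈ P.domain) (n : ℕ) :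
    ‖P.coord (g ^ n) - (n : ℚ_[p]) • P.coord g‖ ≤
      (p : ℝ)⁻¹ * (‖(n : ℚ_[p])‖ * ‖P.coord g‖) := by
  have hp : (p : ℝ)⁻¹ ≤ 1 := inv_le_one_of_one_le₀ (mod_cast (Fact.out : p.Prime).one_le)
  have hε : (p : ℝ)⁻¹ ^ 2 ≤ (p : ℝ)⁻¹ := pow_le_of_le_one (by positivity) hp two_ne_zero
  induction n using Nat.recOnMul generalizing g with
  | zero => simp [P.coord_one]
  | one => simpa using by positivity
  | prime ℓ hℓ =>
    have h := P.norm_coord_pow_sub_nsmul_le (by positivity) (hε.trans hp) hg ℓ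
    rw [← Nat.cast_smul_eq_nsmul ℚ_[p]] at h
    refine h.trans ?_
    rw [← mul_assoc]
    gcongr
    obtain rfl | hne := eq_or_ne ℓ p
    · rw [Padic.norm_p, sq]
    · rwa [Padic.norm_natCast_eq_one_iff.2 ((Nat.coprime_primes Fact.out hℓ).2 hne.symm), mul_one]
  | mul a b iha ihb =>
    have hga : ‖P.coord (g ^ a)‖ ≤ ‖(a : ℚ_[p])‖ * ‖P.coord g‖ :=
      norm_le_of_norm_sub_le ((iha hg).trans (mul_le_of_le_one_left (by positivity) hp))
        (norm_smul _ _).le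
    have h₁ : ‖P.coord (g ^ (a * b)) - (b : ℚ_[p]) • P.coord (g ^ a)‖ ≤
        (p : ℝ)⁻¹ * (‖((a * b : ℕ) : ℚ_[p])‖ * ‖P.coord g‖) := by
      rw [pow_mul]
      refine (ihb (pow_mem hg a)).trans ?_
      rw [Nat.cast_mul, norm_mul, mul_comm ‖(a : ℚ_[p])‖, mul_assoc ‖(b : ℚ_[p])‖]
      gcongr
    have h₂ : ‖(b : ℚ_[p]) • (P.coord (g ^ a) - (a : ℚ_[p]) • P.coord g)‖ ≤
        (p : ℝ)⁻¹ * (‖((a * b : ℕ) : ℚ_[p])‖ * ‖P.coord g‖) := by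
      rw [norm_smul, Nat.cast_mul, norm_mul]
      refine (mul_le_mul_of_nonneg_left (iha hg) (norm_nonneg _)).trans_eq ?_
      ring
    refine norm_le_of_norm_sub_le ?_ h₂
    convert h₁ using 2
    push_cast
    module

end Padic

end AlmostAdditiveChart

theorem exists_norm_natCast_mul_sub_le {p : ℕ} [Fact p.Prime] {a u : ℚ_[p]} (ha : a ≠ 0)
    (hu : ‖u‖ ≤ ‖a‖) {δ : ℝ} (hδ : 0 < δ) : ∃ n : ℕ, ‖(n : ℚ_[p]) * a - u‖ ≤ δ := by
  have ha' : 0 < ‖a‖ := norm_pos_iff.2 ha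
  have hw : ‖u / a‖ ≤ 1 := by rw [norm_div]; exact div_le_one_of_le₀ hu ha'.le
  obtain ⟨w, hwu⟩ : ∃ w : ℤ_[p], (w : ℚ_[p]) = u / a := ⟨⟨u / a, hw⟩, rfl⟩
  obtain ⟨n, hn⟩ := PadicInt.denseRange_natCast.exists_dist_lt w (div_pos hδ ha')
  refine ⟨n, ?_⟩
  rw [dist_comm, dist_eq_norm, PadicInt.norm_def, PadicInt.coe_sub, PadicInt.coe_natCast,
    hwu, lt_div_iff₀ ha', ← norm_mul, sub_mul, div_mul_cancel₀ _ ha] at hn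
  exact hn.le

theorem eq_fst_add_snd_of_hasFDerivAt {𝕜 E : Type*} [NontriviallyNormedField 𝕜]
    [NormedAddCommGroup E] [NormedSpace 𝕜 E] {F : E × E → E} {L : E × E →L[𝕜] E} {a : E}
    (hF : HasFDerivAt F L (a, a)) (hleft : ∀ᶠ x in 𝓝 a, F (x, a) = x)
    (hright : ∀ᶠ x in 𝓝 a, F (a, x) = x) :
    L = ContinuousLinearMap.fst 𝕜 E E + ContinuousLinearMap.snd 𝕜 E E := by
  have hinl : L.comp (ContinuousLinearMap.inl 𝕜 E E) = ContinuousLinearMap.id 𝕜 E :=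
    (HasFDerivAt.comp a (f := fun x => (x, a)) hF (hasFDerivAt_prodMk_left a a)).unique
      ((hasFDerivAt_id a).congr_of_eventuallyEq hleft)
  have hinr : L.comp (ContinuousLinearMap.inr 𝕜 E E) = ContinuousLinearMap.id 𝕜 E :=
    (HasFDerivAt.comp a (f := fun x => (a, x)) hF (hasFDerivAt_prodMk_right a a)).unique
      ((hasFDerivAt_id a).congr_of_eventuallyEq hright)
  ext x
  · simpa using DFunLike.congr_fun hinl x
  · simpa using DFunLike.congr_fun hinr x

section ChartAtOne

variable (𝕜 E G : Type*) [NontriviallyNormedField 𝕜] [NormedAddCommGroup E] [NormedSpace 𝕜 E]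
  [Group G] [TopologicalSpace G] [ChartedSpace E G]

theorem chartAt_symm_apply_chartAt_one : (chartAt E (1 : G)).symm (chartAt E (1 : G) 1) = 1 :=
  (chartAt E (1 : G)).left_inv (mem_chart_source E 1)

theorem hasStrictFDerivAt_mul_chartAt_one [LieGroup 𝓘(𝕜, E) ω G] :
    HasStrictFDerivAt (𝕜 := 𝕜)
      (fun q : E × E => chartAt E (1 : G)
        ((chartAt E (1 : G)).symm q.1 * (chartAt E (1 : G)).symm q.2))
      (ContinuousLinearMap.fst 𝕜 E E + ContinuousLinearMap.snd 𝕜 E E)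
      (chartAt E (1 : G) 1, chartAt E (1 : G) 1) := by
  have hsymm := chartAt_symm_apply_chartAt_one E G
  have htarget := chart_target_mem_nhds E (1 : G)
  have hmul := contMDiff_mul 𝓘(𝕜, E) ω ((1 : G), (1 : G))
  set e := chartAt E (1 : G)
  have hF : ContDiffAt 𝕜 ω (fun q : E × E => e (e.symm q.1 * e.symm q.2)) (e 1, e 1) := by
    have h := (contMDiffAt_iff.1 hmul).2
    simp only [mul_one, mfld_simps] at h
    exact h.contDiffAt (by simp)
  have hderiv := hF.analyticAt.hasStrictFDerivAt
  rwa [eq_fst_add_snd_of_hasFDerivAt hderiv.hasFDerivAt] at hderiv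
  · filter_upwards [htarget] with x hx
    rw [hsymm, mul_one, e.right_inv hx]
  · filter_upwards [htarget] with x hx
    rw [hsymm, one_mul, e.right_inv hx]

theorem exists_mem_nhds_one_norm_chartAt_mul_sub_le [LieGroup 𝓘(𝕜, E) ω G]
    {ε : ℝ} (hε : 0 < ε) :
    ∃ s ∈ 𝓝 (1 : G), ∀ g ∈ s, ∀ h ∈ s, ∀ g' ∈ s, ∀ h' ∈ s,
      ‖chartAt E 1 (g * h) - chartAt E 1 (g' * h') -
          (chartAt E 1 g - chartAt E 1 g' + (chartAt E 1 h - chartAt E 1 h'))‖ ≤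
        ε * max ‖chartAt E 1 g - chartAt E 1 g'‖ ‖chartAt E 1 h - chartAt E 1 h'‖ := by
  have hF := (hasStrictFDerivAt_iff_isLittleO.1 (hasStrictFDerivAt_mul_chartAt_one 𝕜 E G)).def hε
  have hsource := chart_source_mem_nhds E (1 : G)
  have hcont := (chartAt E (1 : G)).continuousAt (mem_chart_source E 1)
  set e := chartAt E (1 : G)
  have hcont₄ : ContinuousAt (Prod.map (Prod.map e e) (Prod.map e e)) ((1, 1), (1, 1)) :=
    (hcont.prodMap hcont).prodMap (hcont.prodMap hcont)
  have hpull := hcont₄.eventually hF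
  simp only [nhds_prod_eq] at hpull
  obtain ⟨t, ht, htF⟩ := mem_prod_self_iff.1 hpull
  obtain ⟨s, hs, hst⟩ := mem_prod_self_iff.1 ht
  refine ⟨s ∩ e.source, inter_mem hs hsource, fun g hg h hh g' hg' h' hh' => ?_⟩
  have hest := htF (a := ((g, h), (g', h')))
    ⟨hst (mk_mem_prod hg.1 hh.1), hst (mk_mem_prod hg'.1 hh'.1)⟩
  simpa [e.left_inv hg.2, e.left_inv hh.2, e.left_inv hg'.2, e.left_inv hh'.2, Prod.norm_def]
    using hest

variable {G}

theorem exists_closedBall_subset_chartAt_target {U : Set G} (hU : U ∈ 𝓝 1) :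
    ∃ r > 0, closedBall (chartAt E 1 (1 : G)) r ⊆ (chartAt E (1 : G)).target ∧
      (chartAt E 1).source ∩ chartAt E 1 ⁻¹' closedBall (chartAt E 1 (1 : G)) r ⊆ U := by
  have htarget := chart_target_mem_nhds E (1 : G)
  have hsymm := (chartAt E (1 : G)).continuousAt_symm (mem_chart_target E 1)
  rw [ContinuousAt, chartAt_symm_apply_chartAt_one] at hsymm
  obtain ⟨r, hr, hrU⟩ := nhds_basis_closedBall.mem_iff.1 (inter_mem htarget (hsymm hU))
  refine ⟨r, hr, fun x hx => (hrU hx).1, fun g hg => ?_⟩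
  simpa [(chartAt E (1 : G)).left_inv hg.1] using (hrU hg.2).2

theorem exists_submonoid_eq_chartAt_preimage_closedBall [IsUltrametricDist E]
    [LieGroup 𝓘(𝕜, E) ω G] {U : Set G} (hU : U ∈ 𝓝 1) :
    ∃ (D : Submonoid G) (r : ℝ), 0 < r ∧
      closedBall (chartAt E 1 (1 : G)) r ⊆ (chartAt E (1 : G)).target ∧ (D : Set G) ⊆ U ∧
      (D : Set G) = (chartAt E 1).source ∩ chartAt E 1 ⁻¹' closedBall (chartAt E 1 (1 : G)) r := by
  have := topologicalGroup_of_lieGroup 𝓘(𝕜, E) ω (G := G)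
  obtain ⟨s, hs, hest⟩ := exists_mem_nhds_one_norm_chartAt_mul_sub_le 𝕜 E G one_pos
  obtain ⟨W, hW, hWmul⟩ := exists_nhds_one_split (chart_source_mem_nhds E (1 : G))
  obtain ⟨r, hr, hrtarget, hrU⟩ := exists_closedBall_subset_chartAt_target E
    (inter_mem hU (inter_mem hs hW))
  have h1 := mem_chart_source E (1 : G)
  set e := chartAt E (1 : G)
  refine ⟨{ carrier := e.source ∩ e ⁻¹' closedBall (e 1) r
            one_mem' := ⟨h1, mem_closedBall_self hr.le⟩
            mul_mem' := fun {g h} hg hh => ?_ },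
    r, hr, hrtarget, fun g hg => (hrU hg).1, rfl⟩
  refine ⟨hWmul g (hrU hg).2.2 h (hrU hh).2.2, mem_closedBall_iff_norm.2 ?_⟩
  have hmax : max ‖e g - e 1‖ ‖e h - e 1‖ ≤ r :=
    max_le (mem_closedBall_iff_norm.1 hg.2) (mem_closedBall_iff_norm.1 hh.2)
  have hmul := hest g (hrU hg).2.1 h (hrU hh).2.1 1 (mem_of_mem_nhds hs) 1 (mem_of_mem_nhds hs)
  rw [mul_one, one_mul] at hmul
  exact norm_le_of_norm_sub_le (hmul.trans hmax)
    ((IsUltrametricDist.norm_add_le_max _ _).trans hmax)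

theorem exists_almostAdditiveChart [ProperSpace E] [IsUltrametricDist E]
    [LieGroup 𝓘(𝕜, E) ω G] {U : Set G} (hU : U ∈ 𝓝 1) {ε : ℝ} (hε : 0 < ε) :
    ∃ P : AlmostAdditiveChart G E ε, (P.domain : Set G) ⊆ U := by
  obtain ⟨s, hs, hest⟩ := exists_mem_nhds_one_norm_chartAt_mul_sub_le 𝕜 E G hε
  obtain ⟨D, r, hr, hrtarget, hDU, hD⟩ :=
    exists_submonoid_eq_chartAt_preimage_closedBall 𝕜 E (inter_mem hU hs)
  have hsource := chart_source_mem_nhds E (1 : G)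
  have hcont := (chartAt E (1 : G)).continuousAt (mem_chart_source E 1)
  set e := chartAt E (1 : G)
  have hDsymm : (D : Set G) = e.symm '' closedBall (e 1) r :=
    hD.trans (e.symm_image_eq_source_inter_preimage hrtarget).symm
  have hDe {g} (hg : g ∈ D) : g ∈ e.source ∧ e g ∈ closedBall (e 1) r := hD.subset hg
  refine ⟨{ domain := D
            coord := fun g => e g - e 1
            radius := r
            radius_pos := hr
            domain_mem_nhds :=
              hD ▸ inter_mem hsource (hcont.preimage_mem_nhds (closedBall_mem_nhds _ hr))
            isCompact_domain := hDsymm ▸ (isCompact_closedBall _ _).image_of_continuousOn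
              (e.continuousOn_symm.mono hrtarget)
            continuousOn_coord :=
              (e.continuousOn.mono fun g hg => (hDe hg).1).sub continuousOn_const
            bijOn_coord := ⟨fun g hg => by simpa [dist_eq_norm] using (hDe hg).2,
              fun g hg h hh hgh => e.injOn (hDe hg).1 (hDe hh).1 (sub_left_injective hgh), ?_⟩
            coord_one := sub_self _
            norm_coord_mul_sub_le := fun g hg h hh g' hg' h' hh' => by
              simpa only [sub_sub_sub_cancel_right] using
                hest g (hDU hg).2 h (hDU hh).2 g' (hDU hg').2 h' (hDU hh').2 },
    fun g hg => (hDU hg).1⟩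
  intro x hx
  have hx' : x + e 1 ∈ closedBall (e 1) r := by simpa [dist_eq_norm] using hx
  refine ⟨e.symm (x + e 1), hDsymm ▸ mem_image_of_mem _ hx', ?_⟩
  simp [e.right_inv (hrtarget hx')]

end ChartAtOne

section PadicCoordinates

variable {p : ℕ} [Fact p.Prime] {G : Type*} [Group G] [TopologicalSpace G]

namespace AlmostAdditiveChart

theorem exists_mem_powers_norm_coord_sub_smul_le {E : Type*} [NormedAddCommGroup E]
    [NormedSpace ℚ_[p] E] [IsUltrametricDist E] (P : AlmostAdditiveChart G E ((p : ℝ)⁻¹ ^ 2))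
    {g : G} (hg : g ∈ P.domain) {M : ℕ} (hM : M ≠ 0) {a : ℚ_[p]} (ha : ‖a‖ ≤ ‖(M : ℚ_[p])‖) :
    ∃ b ∈ Submonoid.powers (g ^ M),
      ‖P.coord b - a • P.coord g‖ ≤ (p : ℝ)⁻¹ * (‖a‖ * ‖P.coord g‖) := by
  have hp0 : 0 < (p : ℝ)⁻¹ := inv_pos.2 (mod_cast (Fact.out : p.Prime).pos)
  have hp1 : (p : ℝ)⁻¹ ≤ 1 := inv_le_one_of_one_le₀ (mod_cast (Fact.out : p.Prime).one_le)
  obtain rfl | ha0 := eq_or_ne a 0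
  · exact ⟨1, one_mem _, by simp [P.coord_one]⟩
  have hδ : 0 < (p : ℝ)⁻¹ * ‖a‖ := mul_pos hp0 (norm_pos_iff.2 ha0)
  obtain ⟨m, hm⟩ := exists_norm_natCast_mul_sub_le (Nat.cast_ne_zero.2 hM) ha hδ
  have hma : ‖((m * M : ℕ) : ℚ_[p])‖ ≤ ‖a‖ :=
    norm_le_of_norm_sub_le (y := a)
      (by simpa using hm.trans (mul_le_of_le_one_left (norm_nonneg a) hp1)) le_rfl
  refine ⟨g ^ (m * M), ⟨m, by rw [mul_comm, pow_mul]⟩, ?_⟩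
  have hlin : ‖((m * M : ℕ) : ℚ_[p]) • P.coord g - a • P.coord g‖ ≤
      (p : ℝ)⁻¹ * (‖a‖ * ‖P.coord g‖) := by
    rw [← sub_smul, norm_smul, ← mul_assoc, Nat.cast_mul]
    gcongr
  have hpow := (P.norm_coord_pow_sub_smul_le hg (m * M)).trans
    (show _ ≤ (p : ℝ)⁻¹ * (‖a‖ * ‖P.coord g‖) by gcongr)
  refine norm_le_of_norm_sub_le (y := ((m * M : ℕ) : ℚ_[p]) • P.coord g - a • P.coord g) ?_ hlin
  rwa [sub_sub_sub_cancel_right]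

variable {d : ℕ} (P : AlmostAdditiveChart G (Fin d → ℚ_[p]) ((p : ℝ)⁻¹ ^ 2))

theorem exists_mem_powers_norm_sum_coord_sub_lt {π : ℚ_[p]} (hπ : π ≠ 0) {g : Fin d → G}
    (hg : ∀ i, g i ∈ P.domain) (hgπ : ∀ i, P.coord (g i) = Pi.single i π) {M : ℕ} (hM : M ≠ 0)
    {u : Fin d → ℚ_[p]} (hu : u ≠ 0) (huM : ‖u‖ ≤ ‖(M : ℚ_[p])‖ * ‖π‖) :
    ∃ b : Fin d → G, (∀ i, b i ∈ Submonoid.powers (g i ^ M)) ∧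
      (∀ i, ‖P.coord (b i)‖ ≤ ‖u‖) ∧ ‖∑ i, P.coord (b i) - u‖ < ‖u‖ := by
  have hp1 : (p : ℝ)⁻¹ < 1 := inv_lt_one_of_one_lt₀ (mod_cast (Fact.out : p.Prime).one_lt)
  have hsingle (i) (x : ℚ_[p]) : ‖(Pi.single i x : Fin d → ℚ_[p])‖ = ‖x‖ := Pi.norm_single ..
  have hquot (i) : ‖u i / π‖ ≤ ‖(M : ℚ_[p])‖ := by
    rw [norm_div]
    exact div_le_of_le_mul₀ (norm_nonneg _) (norm_nonneg _) ((norm_le_pi_norm u i).trans huM)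
  choose b hb hbu using fun i => P.exists_mem_powers_norm_coord_sub_smul_le (hg i) hM (hquot i)
  have hbu' (i) : ‖P.coord (b i) - Pi.single i (u i)‖ ≤ (p : ℝ)⁻¹ * ‖u‖ := by
    have h := hbu i
    rw [hgπ, hsingle, ← norm_mul, ← Pi.single_smul, smul_eq_mul, div_mul_cancel₀ _ hπ] at h
    exact h.trans (by gcongr; exact norm_le_pi_norm u i)
  have hlt : (p : ℝ)⁻¹ * ‖u‖ < ‖u‖ := mul_lt_of_lt_one_left (norm_pos_iff.2 hu) hp1
  refine ⟨b, hb, fun i => norm_le_of_norm_sub_le ((hbu' i).trans hlt.le)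
    ((hsingle i _).trans_le (norm_le_pi_norm u i)), lt_of_le_of_lt ?_ hlt⟩
  calc ‖∑ i, P.coord (b i) - u‖ = ‖∑ i, (P.coord (b i) - Pi.single i (u i))‖ := by
        rw [Finset.sum_sub_distrib, Finset.univ_sum_single]
    _ ≤ (p : ℝ)⁻¹ * ‖u‖ :=
        IsUltrametricDist.norm_sum_le_of_forall_le_of_nonneg (by positivity) fun i _ => hbu' i

theorem list_prod_closedZPowers_pow_mem_nhds [IsTopologicalGroup G] {π : ℚ_[p]} (hπ : π ≠ 0)
    {g : Fin d → G} (hg : ∀ i, g i ∈ P.domain) (hgπ : ∀ i, P.coord (g i) = Pi.single i π)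
    {M : ℕ} (hM : M ≠ 0) :
    (List.ofFn fun i => (closedZPowers (g i ^ M) : Set G)).prod ∈ 𝓝 1 := by
  have hp0 : 0 < (p : ℝ)⁻¹ := inv_pos.2 (mod_cast (Fact.out : p.Prime).pos)
  have hp1 : (p : ℝ)⁻¹ < 1 := inv_lt_one_of_one_lt₀ (mod_cast (Fact.out : p.Prime).one_lt)
  have ht : 0 < ‖(M : ℚ_[p])‖ * ‖π‖ :=
    mul_pos (norm_pos_iff.2 (Nat.cast_ne_zero.2 hM)) (norm_pos_iff.2 hπ)
  filter_upwards [P.setOf_norm_coord_le_mem_nhds ht] with x hx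
  refine P.mem_list_prod_of_norm_coord_le (by positivity) (pow_lt_one₀ hp0.le hp1 two_ne_zero)
    (S := fun i => (closedZPowers (g i ^ M)).toSubmonoid) (fun i => isClosed_closedZPowers _)
    (fun u hu hut => ?_) hx.1 hx.2
  obtain ⟨b, hb, hbu, hsum⟩ := P.exists_mem_powers_norm_sum_coord_sub_lt hπ hg hgπ hM hu hut
  refine ⟨b, fun i => ⟨?_, ?_⟩, hbu, hsum⟩
  · exact Submonoid.powers_le.2 (pow_mem (hg i) M) (hb i)
  · exact Submonoid.powers_le.2 (zpowers_le_closedZPowers _ (Subgroup.mem_zpowers _)) (hb i)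

end AlmostAdditiveChart

namespace IsPAdicAnalyticGroup

theorem t2Space [IsTopologicalGroup G] (hG : IsPAdicAnalyticGroup p G) : T2Space G := by
  obtain ⟨d, hC, -⟩ := hG
  have := ChartedSpace.t1Space (Fin d → ℚ_[p]) G
  infer_instance

theorem isLocallyProductOfClosedZPowers [IsTopologicalGroup G] (hG : IsPAdicAnalyticGroup p G) :
    IsLocallyProductOfClosedZPowers G := by
  obtain ⟨d, hC, hL⟩ := hG
  have hp : 0 < (p : ℝ)⁻¹ := inv_pos.2 (mod_cast (Fact.out : p.Prime).pos)
  intro U hU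
  obtain ⟨P, hPU⟩ := exists_almostAdditiveChart ℚ_[p] (Fin d → ℚ_[p]) hU (pow_pos hp 2)
  obtain ⟨π, hπ0, hπ⟩ := NormedField.exists_norm_lt ℚ_[p] P.radius_pos
  have hsingle (i) : (Pi.single i π : Fin d → ℚ_[p]) ∈ closedBall 0 P.radius := by
    rw [mem_closedBall_zero_iff, Pi.norm_single]
    exact hπ.le
  choose g hg hgπ using fun i => P.bijOn_coord.surjOn (hsingle i)
  exact ⟨d, g, fun i => hPU (hg i), fun M hM =>
    P.list_prod_closedZPowers_pow_mem_nhds (norm_pos_iff.1 hπ0) hg hgπ hM⟩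

end IsPAdicAnalyticGroup

end PadicCoordinates

theorem corollary4p3_general {G : Type*} [Group G] [TopologicalSpace G] [IsTopologicalGroup G]
    [T2Space G] (hK : ∃ K : Subgroup G, IsOpen (K : Set G) ∧ IsCompact (K : Set G))
    (hG : IsLocallyProductOfClosedZPowers G) {k : Type*} [Field k] (hk : 0 < ringChar k)
    {V : Type*} [AddCommGroup V] [Module k V] (ρ : Representation k G V) :
    SmoothRep.smoothPart (SmoothRep.quotientSmoothPart ρ) = ⊥ := by
  refine (Submodule.eq_bot_iff _).2 fun w hw => ?_
  obtain ⟨v, rfl⟩ := Submodule.mkQ_surjective _ w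
  obtain ⟨K, hKo, hKc, hKv⟩ := (SmoothRep.mem_smoothPart_iff hK _ _).1 hw
  have hv : ∀ g ∈ K, IsOpen (SmoothRep.stabilizer ρ (ρ g v - v) : Set G) := fun g hg =>
    (SmoothRep.mem_smoothPart_iff_isOpen_stabilizer hK).1 <|
      (Submodule.Quotient.eq _).1 (hKv g hg)
  obtain ⟨d, g, hgK, hg⟩ := hG K (hKo.mem_nhds K.one_mem)
  rw [Submodule.mkQ_apply, Submodule.Quotient.mk_eq_zero,
    SmoothRep.mem_smoothPart_iff_isOpen_stabilizer hK]
  exact isOpen_of_closedZPowers_pow_le hg fun i =>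
    SmoothRep.exists_closedZPowers_pow_le_stabilizer hk.ne' (CharP.cast_eq_zero k _) hKc hv (hgK i)

theorem corollary4p3 {p : ℕ} [Fact p.Prime]
    {G : Type*} [Group G] [TopologicalSpace G] [IsTopologicalGroup G]
    (hG : IsPAdicAnalyticGroup p G)
    {k : Type*} [Field k] (hk : 0 < ringChar k)
    {V : Type*} [AddCommGroup V] [Module k V] (ρ : Representation k G V) :
    SmoothRep.smoothPart (SmoothRep.quotientSmoothPart ρ) = ⊥ := by
  have := hG.t2Space
  exact corollary4p3_general hG.exists_compact_open_subgroup hG.isLocallyProductOfClosedZPowers hk ρ
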